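/- **Theorem (Diffeology of the half-lines).** A Euclidean domain is an open subset of some $\mathbf{R}^k$, and plots of $\mathbf{R}^n$ are the $C^\infty$ maps from Euclidean domains. For a surjection $\pi : X \to Q$ from a diffeological space $X$, the quotient diffeology on $Q$ consists of the parametrizations that lift locally along $\pi$ to plots of $X$. For $n \in \mathbf{N}$ let $\Delta_n = \mathbf{R}^n/O(n)$ with the quotient diffeology, and for $\delta \in \Delta_n$ the class of $x$, let $t(\delta) = \|x\|^2 \in [0,\infty[$. Let $\Delta_\infty = [0,\infty[$ with the subset diffeology of $\mathbf{R}$ (plots are the smooth real-valued maps with values in $[0,\infty[$), with coordinate $t(\delta) = \delta$. For a diffeological space $X$ and $x \in X$, a plot centered at $x$ is a plot $P : U \to X$ with $0 \in U$ and $P(0) = x$. A family $\mathcal F$ of plots centered at $x$ generates the germ of the diffeology at $x$ if every plot centered at $x$ is, on some open neighbourhood of $0$, either constant or of the form $F \circ \varphi$ with $F \in \mathcal F$ and $\varphi$ a smooth map with $\varphi(0) = 0$ and values in the domain of $F$. Put $$\dim_x(X) = \inf_{\mathcal F} \ \sup_{F \in \mathcal F} \dim(\mathrm{dom}\, F) \in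 \mathbf{N} \cup \{\infty\},$$ the infimum being over all families $\mathcal F$ that generate the germ at $x$. Then: 1. For every $n \ge 1$, the map $\delta \mapsto t(\delta)$ is a diffeomorphism from $\Delta_n$ to $[0,\infty[$ equipped with the quotient diffeology along $\mathrm{sq} : \mathbf{R}^n \to [0,\infty[$, $\mathrm{sq}(x) = \|x\|^2$. 2. For $n \neq m$ in $\mathbf{N}$, $\Delta_n$ and $\Delta_m$ are not diffeomorphic. 3. For every $n \in \mathbf{N}$, $\Delta_n$ is not diffeomorphic to $\Delta_\infty$. 4. The dimension map is a diffeological invariant: if $f : X \to Y$ is a diffeomorphism of diffeological spaces, then $\dim_{f(x)}(Y) = \dim_x(X)$ for all $x \in X$. 5. For every $n \in \mathbf{N}$ and $\delta \in \Delta_n$: if $t(\delta) = 0$ then $\dim_\delta(\Delta_n) = n$, and if $t(\delta) > 0$ then $\dim_\delta(\Delta_n) = 1$. 6. For $\delta \in \Delta_\infty$: if $t(\delta) = 0$ then $\dim_\delta(\Delta_\infty) = \infty$, and if $t(\delta) > 0$ then $\dim_\delta(\Delta_\infty) = 1$. -/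

import Mathlib

open scoped ContDiff
open Diffeology

noncomputable section

namespace HalfLines

/-- The Euclidean space `ℝⁿ`; Mathlib gives it its standard diffeology
(plots are the ordinary smooth maps). -/
abbrev E (n : ℕ) : Type := EuclideanSpace ℝ (Fin n)

/-! ### Diffeomorphisms -/

/-- A diffeomorphism of diffeological spaces: a bijection, smooth in both directions. -/
structure Diffeo (X : Type*) (Y : Type*) [DiffeologicalSpace X] [DiffeologicalSpace Y]
    extends X ≃ Y where
  smooth_toFun : DSmooth toFun
  smooth_invFun : DSmooth invFun

/-- Two diffeological spaces are diffeomorphic. -/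
def Diffeomorphic (X : Type*) (Y : Type*) [DiffeologicalSpace X] [DiffeologicalSpace Y] : Prop :=
  Nonempty (Diffeo X Y)

/-! ### Plots on open subsets of `ℝⁿ` -/

/-- The parametrization `p`, restricted to the Euclidean domain `U`, is a plot of `X`
(the values of `p` outside `U` are irrelevant). In Mathlib a diffeology is given by its plots
defined on whole spaces `ℝᵐ`; the restriction of `p` to the open set `U` is a plot exactly if all
its composites with smooth maps `ℝᵐ → U` are. -/
def IsPlotOn {X : Type*} [DiffeologicalSpace X] {n : ℕ} (p : E n → X) (U : Set (E n)) : Prop :=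
  ∀ (m : ℕ) (f : E m → E n), ContDiff ℝ ∞ f → (∀ y, f y ∈ U) → IsPlot (p ∘ f)

theorem isPlotOn_univ {X : Type*} [DiffeologicalSpace X] {n : ℕ} {p : E n → X} :
    IsPlotOn p Set.univ ↔ IsPlot p :=
  ⟨fun h => h n id contDiff_id fun _ => trivial, fun h _ _ hf _ => isPlot_reparam h hf⟩

theorem IsPlotOn.comp {X : Type*} [DiffeologicalSpace X] {n m : ℕ} {p : E n → X}
    {U : Set (E n)} {V : Set (E m)} {f : E m → E n} (hp : IsPlotOn p U)
    (hf : ContDiffOn ℝ ∞ f V) (hV : ∀ y ∈ V, f y ∈ U) : IsPlotOn (p ∘ f) V := by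
  intro k g hg hgV
  exact hp k (f ∘ g) (hf.comp_contDiff hg hgV) fun y => hV _ (hgV y)

/-! ### Quotient and subset diffeologies -/

/-- The quotient diffeology on `Q` along a surjection `π : X → Q`: the plots are the
parametrizations that lift locally, along `π`, to plots of `X`. -/
@[reducible]
def quotientDiffeology {X Q : Type*} [DiffeologicalSpace X] (π : X → Q)
    (hπ : Function.Surjective π) : DiffeologicalSpace Q :=
  .ofCorePlotsOn {
    isPlotOn := fun {n u} _ p => ∀ r ∈ u, ∃ V : Set (E n), IsOpen V ∧ r ∈ V ∧ V ⊆ u ∧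
      ∃ q : E n → X, IsPlotOn q V ∧ ∀ s ∈ V, p s = π (q s)
    isPlotOn_congr := by
      intro n u hu p q h
      constructor
      · intro H r hr
        obtain ⟨V, hV, hrV, hVu, x, hx, hpx⟩ := H r hr
        exact ⟨V, hV, hrV, hVu, x, hx, fun s hs => (h (hVu hs)).symm.trans (hpx s hs)⟩
      · intro H r hr
        obtain ⟨V, hV, hrV, hVu, x, hx, hpx⟩ := H r hr
        exact ⟨V, hV, hrV, hVu, x, hx, fun s hs => (h (hVu hs)).trans (hpx s hs)⟩
    isPlot := fun {n} p => ∀ r, ∃ V : Set (E n), IsOpen V ∧ r ∈ V ∧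
      ∃ q : E n → X, IsPlotOn q V ∧ ∀ s ∈ V, p s = π (q s)
    isPlotOn_univ := by
      intro n p
      simp
    isPlot_const := by
      intro n x r
      obtain ⟨y, hy⟩ := hπ x
      exact ⟨Set.univ, isOpen_univ, trivial, fun _ => y, isPlotOn_univ.2 isPlot_const,
        fun _ _ => hy.symm⟩
    isPlotOn_reparam := by
      intro n m u v hu hv p f hfv hp hf r hr
      obtain ⟨V, hV, hrV, hVu, x, hx, hpx⟩ := hp (f r) (hfv hr)
      refine ⟨v ∩ f ⁻¹' V, hf.continuousOn.isOpen_inter_preimage hv hV, ⟨hr, hrV⟩,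
        Set.inter_subset_left, x ∘ f,
        hx.comp (hf.mono Set.inter_subset_left) fun y hy => hy.2, fun s hs => hpx _ hs.2⟩
    locality := by
      intro n u hu p hp r hr
      obtain ⟨v, hv, hrv, hpv⟩ := hp r hr
      obtain ⟨V, hV, hrV, hVv, x, hx, hpx⟩ := hpv r hrv
      refine ⟨V ∩ u, hV.inter hu, ⟨hrV, hr⟩, Set.inter_subset_right, x, ?_,
        fun s hs => hpx s hs.1⟩
      exact fun m f hf hfV => hx m f hf fun y => (hfV y).1 }

/-- The subset diffeology on `A ⊆ X`: the plots are the plots of `X` with values in `A`. -/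
@[reducible]
def subsetDiffeology {X : Type*} [DiffeologicalSpace X] (A : Set X) : DiffeologicalSpace A where
  plots _ := {p | IsPlot (fun r => (p r : X))}
  constant_plots _ := isPlot_const
  plot_reparam {_ _ p _} hp hf := isPlot_reparam (p := fun r => (p r : X)) hp hf
  locality {n p} h := DiffeologicalSpace.locality (p := fun r => (p r : X)) h

/-! ### The half-lines -/

/-- The orbit equivalence relation of the orthogonal group `O(n)`, that is the group of linear
isometries of the Euclidean space `ℝⁿ`. -/
def orbitSetoid (n : ℕ) : Setoid (E n) where
  r x y := ∃ g : E n ≃ₗᵢ[ℝ] E n, g x = y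
  iseqv :=
    { refl := fun _ => ⟨LinearIsometryEquiv.refl ℝ _, rfl⟩
      symm := by
        rintro x y ⟨g, rfl⟩
        exact ⟨g.symm, g.symm_apply_apply x⟩
      trans := by
        rintro x y z ⟨g, rfl⟩ ⟨h, rfl⟩
        exact ⟨g.trans h, rfl⟩ }

/-- `Δ_n = ℝⁿ / O(n)`. -/
def Delta (n : ℕ) : Type := Quotient (orbitSetoid n)

/-- The projection `ℝⁿ → Δ_n`. -/
def Delta.mk {n : ℕ} (x : E n) : Delta n := Quotient.mk (orbitSetoid n) x

theorem Delta.mk_surjective {n : ℕ} : Function.Surjective (Delta.mk (n := n)) :=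
  Quotient.mk_surjective

/-- `Δ_n` carries the quotient diffeology of `ℝⁿ`. -/
instance (n : ℕ) : DiffeologicalSpace (Delta n) :=
  quotientDiffeology Delta.mk Delta.mk_surjective

/-- The map `sq : ℝⁿ → [0, ∞[`, `x ↦ ‖x‖²`. -/
def sq (n : ℕ) (x : E n) : Set.Ici (0 : ℝ) := ⟨‖x‖ ^ 2, sq_nonneg ‖x‖⟩

theorem sq_surjective (n : ℕ) [NeZero n] : Function.Surjective (sq n) := by
  rintro ⟨t, ht⟩
  refine ⟨EuclideanSpace.single 0 (Real.sqrt t), Subtype.ext ?_⟩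
  simp [sq, Real.sq_sqrt (Set.mem_Ici.1 ht)]

/-- The map `Δ_n → [0, ∞[` induced by `sq`; it gives the coordinate `t` of a point of `Δ_n`. -/
def Delta.sq {n : ℕ} : Delta n → Set.Ici (0 : ℝ) :=
  Quotient.lift (HalfLines.sq n) (by
    rintro x y ⟨g, rfl⟩
    simp [HalfLines.sq])

/-- The set `[0, ∞[` with the quotient diffeology along `sq : ℝⁿ → [0, ∞[`, for `n ≥ 1`. -/
def QuotientHalfLine (n : ℕ) [NeZero n] : Type := Set.Ici (0 : ℝ)

instance (n : ℕ) [NeZero n] : DiffeologicalSpace (QuotientHalfLine n) :=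
  quotientDiffeology (Q := Set.Ici (0 : ℝ)) (sq n) (sq_surjective n)

/-- The coordinate `t` of a point of the half-line. -/
def QuotientHalfLine.val {n : ℕ} [NeZero n] (δ : QuotientHalfLine n) : ℝ := Subtype.val δ

/-- `Δ_∞`, the set `[0, ∞[` with the subset diffeology of `ℝ`. -/
def DeltaInfty : Type := Set.Ici (0 : ℝ)

instance : DiffeologicalSpace DeltaInfty := subsetDiffeology (Set.Ici (0 : ℝ))

/-- The coordinate `t` of a point of `Δ_∞`. -/
def DeltaInfty.val (δ : DeltaInfty) : ℝ := Subtype.val δ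

/-! ### The dimension map -/

/-- A plot of `X` centered at `x`: a plot `P : U → X` on a Euclidean domain `U` with `0 ∈ U` and
`P 0 = x` (the values of `toFun` outside `U` are irrelevant). -/
structure CenteredPlot {X : Type*} [DiffeologicalSpace X] (x : X) where
  /-- the dimension of the domain -/
  dim : ℕ
  /-- the domain `U` -/
  dom : Set (E dim)
  isOpen_dom : IsOpen dom
  zero_mem : 0 ∈ dom
  toFun : E dim → X
  isPlotOn : IsPlotOn toFun dom
  map_zero : toFun 0 = x

/-- The family `F` of plots centered at `x` generates the germ of the diffeology at `x`: near `0`,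
every plot centered at `x` is constant or factors through a member of the family by a smooth map
sending `0` to `0`. -/
def GeneratesAt {X : Type*} [DiffeologicalSpace X] {x : X} (F : Set (CenteredPlot x)) : Prop :=
  ∀ P : CenteredPlot x, ∃ V : Set (E P.dim), IsOpen V ∧ 0 ∈ V ∧ V ⊆ P.dom ∧
    ((∀ r ∈ V, P.toFun r = x) ∨
      ∃ G ∈ F, ∃ φ : E P.dim → E G.dim, ContDiffOn ℝ ∞ φ V ∧ φ 0 = 0 ∧
        ∀ r ∈ V, φ r ∈ G.dom ∧ P.toFun r = G.toFun (φ r))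

/-- The dimension of a family of centered plots, the supremum of the dimensions of the domains. -/
def familyDim {X : Type*} [DiffeologicalSpace X] {x : X} (F : Set (CenteredPlot x)) : ℕ∞ :=
  ⨆ P ∈ F, (P.dim : ℕ∞)

/-- The dimension `dim_x(X) ∈ ℕ ∪ {∞}`, the infimum of the dimensions of the families that
generate the germ of the diffeology at `x`. -/
def dimAt {X : Type*} [DiffeologicalSpace X] (x : X) : ℕ∞ :=
  ⨅ F ∈ {F : Set (CenteredPlot x) | GeneratesAt F}, familyDim F

end HalfLines

end

open scoped ContDiff Topology
open Diffeology Filter Asymptotics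

noncomputable section

namespace HalfLines

/-! ### Plots on open sets -/

section Plots

variable {X Y : Type*} [DiffeologicalSpace X] [DiffeologicalSpace Y] {n : ℕ}

/-! Everything rests on the dimension map, a diffeological invariant because centered plots and
their factorizations transport along diffeomorphisms. At the origin, the lower bound comes from
`le_of_norm_sq_eq_comp`: if `‖r‖² = g (φ r)` near `0` with `g ≥ 0` smooth and `g 0 = 0`, then `g` is
quadratically small, so the derivative of `φ` at `0` kills no vector and `φ` needs at least `n`
target variables. In `Δ_n` the projection realizes `‖r‖²` and, by local lifting, generates the germ,
so the dimension is `n`; in `Δ_∞` every `‖r‖²` is a plot, so the dimension is infinite. Where `t >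
0`, the coordinate `t` is a local chart, so the dimension is `1`. Comparing dimensions at the origin
separates the half-lines. -/

theorem IsPlotOn.dSmooth_comp {p : E n → X} {U : Set (E n)} (hp : IsPlotOn p U) {f : X → Y}
    (hf : DSmooth f) : IsPlotOn (f ∘ p) U :=
  fun m g hg hU => hf m _ (hp m g hg hU)

theorem isPlotOn_of_contDiffOn {F : Type*} [NormedAddCommGroup F] [NormedSpace ℝ F]
    [DiffeologicalSpace F] [IsContDiffCompatible F] {p : E n → F} {U : Set (E n)}
    (hp : ContDiffOn ℝ ∞ p U) : IsPlotOn p U :=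
  fun _ _ hf hU => (hp.comp_contDiff hf hU).isPlot

/-- Smoothness is local, and `univBall` is a diffeomorphism of the whole space onto a ball: it turns
the plot on that ball into a global plot, hence a smooth map, and its inverse brings smoothness
back. -/
theorem IsPlotOn.contDiffOn {F : Type*} [NormedAddCommGroup F] [NormedSpace ℝ F]
    [DiffeologicalSpace F] [IsContDiffCompatible F] {p : E n → F} {U : Set (E n)}
    (hp : IsPlotOn p U) (hU : IsOpen U) : ContDiffOn ℝ ∞ p U := by
  intro r hr
  obtain ⟨ε, hε, hεU⟩ := Metric.isOpen_iff.1 hU r hr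
  let b := OpenPartialHomeomorph.univBall r ε
  have hb : ∀ y, b y ∈ Metric.ball r ε := fun y => by
    rw [← OpenPartialHomeomorph.univBall_target r hε]
    exact b.map_source (by simp [b])
  have hpb : ContDiff ℝ ∞ (p ∘ b) :=
    (hp n b OpenPartialHomeomorph.contDiff_univBall fun y => hεU (hb y)).contDiff
  have h : ContDiffOn ℝ ∞ ((p ∘ b) ∘ b.symm) (Metric.ball r ε) :=
    hpb.comp_contDiffOn OpenPartialHomeomorph.contDiffOn_univBall_symm
  have h' : ContDiffOn ℝ ∞ p (Metric.ball r ε) := h.congr fun y hy => by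
    simp only [Function.comp_apply]
    rw [b.right_inv (by rwa [OpenPartialHomeomorph.univBall_target r hε])]
  exact (h'.contDiffAt (Metric.ball_mem_nhds r hε)).contDiffWithinAt

end Plots

/-! ### Plots of a quotient -/

section Quotient

variable {X Q : Type*} [DiffeologicalSpace X] {π : X → Q} (hπ : Function.Surjective π) {n : ℕ}

theorem isPlot_quotientDiffeology_iff {p : E n → Q} :
    @IsPlot Q (quotientDiffeology π hπ) n p ↔ ∀ r, ∃ V : Set (E n), IsOpen V ∧ r ∈ V ∧
      ∃ q : E n → X, IsPlotOn q V ∧ ∀ s ∈ V, p s = π (q s) :=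
  Iff.rfl

theorem isPlotOn_quotientDiffeology_of_lift {p : E n → Q} {U : Set (E n)} {q : E n → X}
    (hq : IsPlotOn q U) (hpq : ∀ s ∈ U, p s = π (q s)) :
    @IsPlotOn Q (quotientDiffeology π hπ) n p U := by
  intro m f hf hfU
  exact (isPlot_quotientDiffeology_iff hπ).2 fun r => ⟨Set.univ, isOpen_univ, trivial, q ∘ f,
    isPlotOn_univ.2 (hq m f hf hfU), fun s _ => hpq _ (hfU s)⟩

/-- The lifting condition is only given for global plots, so a ball around `r` is again parametrized
by the whole space, and the lift is carried back. -/
theorem exists_lift_of_isPlotOn_quotientDiffeology {p : E n → Q} {U : Set (E n)}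
    (hp : @IsPlotOn Q (quotientDiffeology π hπ) n p U) (hU : IsOpen U) {r : E n} (hr : r ∈ U) :
    ∃ V : Set (E n), IsOpen V ∧ r ∈ V ∧ V ⊆ U ∧
      ∃ q : E n → X, IsPlotOn q V ∧ ∀ s ∈ V, p s = π (q s) := by
  obtain ⟨ε, hε, hεU⟩ := Metric.isOpen_iff.1 hU r hr
  let b := OpenPartialHomeomorph.univBall r ε
  have hbt : b.target = Metric.ball r ε := OpenPartialHomeomorph.univBall_target r hε
  have hb : ∀ y, b y ∈ Metric.ball r ε := fun y => by
    rw [← hbt]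
    exact b.map_source (by simp [b])
  obtain ⟨W, hW, hrW, q, hq, hpq⟩ := (isPlot_quotientDiffeology_iff hπ).1
    (hp n b OpenPartialHomeomorph.contDiff_univBall fun y => hεU (hb y)) (b.symm r)
  have hsymm : ContDiffOn ℝ ∞ b.symm (Metric.ball r ε) :=
    OpenPartialHomeomorph.contDiffOn_univBall_symm
  refine ⟨Metric.ball r ε ∩ b.symm ⁻¹' W,
    hsymm.continuousOn.isOpen_inter_preimage Metric.isOpen_ball hW,
    ⟨Metric.mem_ball_self hε, hrW⟩, Set.inter_subset_left.trans hεU, q ∘ b.symm,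
    hq.comp (hsymm.mono Set.inter_subset_left) fun y hy => hy.2, fun s hs => ?_⟩
  have := hpq _ hs.2
  rwa [Function.comp_apply, b.right_inv (hbt ▸ hs.1)] at this

theorem dSmooth_quotientDiffeology_comp {Y : Type*} [DiffeologicalSpace Y] {f : Q → Y}
    (hf : DSmooth (f ∘ π)) : @DSmooth Q Y (quotientDiffeology π hπ) _ f := by
  intro n p hp
  refine DiffeologicalSpace.locality fun r => ?_
  obtain ⟨V, hV, hrV, q, hq, hpq⟩ := (isPlot_quotientDiffeology_iff hπ).1 hp r
  refine ⟨V, hV, hrV, fun {m g} hgV hg => ?_⟩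
  have := hf m _ (hq m g hg hgV)
  convert! this using 1
  exact funext fun y => congrArg f (hpq _ (hgV y))

end Quotient

/-! ### The dimension map -/

section Dimension

variable {X Y : Type*} [DiffeologicalSpace X] [DiffeologicalSpace Y]

/-- The inverse of a diffeomorphism. -/
def Diffeo.symm (f : Diffeo X Y) : Diffeo Y X where
  toEquiv := f.toEquiv.symm
  smooth_toFun := f.smooth_invFun
  smooth_invFun := f.smooth_toFun

/-- The image of a centered plot under a smooth map. -/
def CenteredPlot.map {f : X → Y} (hf : DSmooth f) {x : X} {y : Y} (hxy : f x = y)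
    (P : CenteredPlot x) : CenteredPlot y where
  dim := P.dim
  dom := P.dom
  isOpen_dom := P.isOpen_dom
  zero_mem := P.zero_mem
  toFun := f ∘ P.toFun
  isPlotOn := P.isPlotOn.dSmooth_comp hf
  map_zero := by rw [Function.comp_apply, P.map_zero, hxy]

theorem Diffeo.generatesAt_image (f : Diffeo X Y) {x : X} {y : Y} (hxy : f.toFun x = y)
    {F : Set (CenteredPlot x)} (hF : GeneratesAt F) :
    GeneratesAt (CenteredPlot.map f.smooth_toFun hxy '' F) := by
  intro P
  have hyx : f.invFun y = x := by rw [← hxy]; exact f.left_inv x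
  obtain ⟨V, hV, h0, hVP, h⟩ := hF (P.map f.smooth_invFun hyx)
  refine ⟨V, hV, h0, hVP, h.imp (fun h r hr => ?_) ?_⟩
  · exact (f.right_inv _).symm.trans ((congrArg f.toFun (h r hr)).trans hxy)
  · rintro ⟨G, hG, φ, hφ, hφ0, hPG⟩
    refine ⟨_, ⟨G, hG, rfl⟩, φ, hφ, hφ0, fun r hr => ⟨(hPG r hr).1, ?_⟩⟩
    calc P.toFun r = f.toFun (f.invFun (P.toFun r)) := (f.right_inv _).symm
      _ = f.toFun (G.toFun (φ r)) := congrArg f.toFun (hPG r hr).2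

theorem Diffeo.dimAt_le (f : Diffeo X Y) {x : X} {y : Y} (hxy : f.toFun x = y) :
    dimAt y ≤ dimAt x := by
  refine le_iInf₂ fun F hF => (iInf₂_le _ (f.generatesAt_image hxy hF)).trans ?_
  refine iSup₂_le ?_
  rintro _ ⟨G, hG, rfl⟩
  exact le_iSup₂ (f := fun (P : CenteredPlot x) (_ : P ∈ F) => (P.dim : ℕ∞)) G hG

theorem Diffeo.dimAt_eq (f : Diffeo X Y) (x : X) : dimAt (f.toFun x) = dimAt x :=
  (f.dimAt_le rfl).antisymm (f.symm.dimAt_le (f.left_inv x))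

/-- If every centered plot factors locally through `G`, the dimension is at most that of `G`. -/
theorem dimAt_le_of_factor {x : X} (G : CenteredPlot x)
    (h : ∀ P : CenteredPlot x, ∃ V : Set (E P.dim), IsOpen V ∧ 0 ∈ V ∧ V ⊆ P.dom ∧
      ∃ φ : E P.dim → E G.dim, ContDiffOn ℝ ∞ φ V ∧ φ 0 = 0 ∧
        ∀ r ∈ V, φ r ∈ G.dom ∧ P.toFun r = G.toFun (φ r)) :
    dimAt x ≤ G.dim := by
  have hG : GeneratesAt {G} := fun P => by
    obtain ⟨V, hV, h0, hVP, φ, hφ⟩ := h P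
    exact ⟨V, hV, h0, hVP, Or.inr ⟨G, rfl, φ, hφ⟩⟩
  refine (iInf₂_le _ hG).trans (iSup₂_le ?_)
  rintro _ rfl
  exact le_rfl

/-- If a plot is not locally constant and factors only through plots of dimension at least `n`,
then the dimension is at least `n`. -/
theorem le_dimAt_of_factor {x : X} (P : CenteredPlot x) {n : ℕ}
    (hP : ∀ V : Set (E P.dim), IsOpen V → 0 ∈ V → V ⊆ P.dom → ∃ r ∈ V, P.toFun r ≠ x)
    (h : ∀ (G : CenteredPlot x) (V : Set (E P.dim)), IsOpen V → 0 ∈ V → V ⊆ P.dom →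
      ∀ φ : E P.dim → E G.dim, ContDiffOn ℝ ∞ φ V → φ 0 = 0 →
        (∀ r ∈ V, φ r ∈ G.dom ∧ P.toFun r = G.toFun (φ r)) → n ≤ G.dim) :
    (n : ℕ∞) ≤ dimAt x := by
  refine le_iInf₂ fun F hF => ?_
  obtain ⟨V, hV, h0, hVP, hc | ⟨G, hG, φ, hφ, hφ0, hPG⟩⟩ := hF P
  · obtain ⟨r, hr, hne⟩ := hP V hV h0 hVP
    exact absurd (hc r hr) hne
  · exact (Nat.cast_le.2 (h G V hV h0 hVP φ hφ hφ0 hPG)).trans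
      (le_iSup₂ (f := fun (P : CenteredPlot x) (_ : P ∈ F) => (P.dim : ℕ∞)) G hG)

/-- A plot factoring through a domain of dimension `0` is constant. -/
theorem one_le_dimAt {x : X} (P : CenteredPlot x)
    (hP : ∀ V : Set (E P.dim), IsOpen V → 0 ∈ V → V ⊆ P.dom → ∃ r ∈ V, P.toFun r ≠ x) :
    1 ≤ dimAt x := by
  refine mod_cast le_dimAt_of_factor P (n := 1) hP fun G V hV h0 hVP φ hφ hφ0 hPG => ?_
  by_contra hlt
  obtain ⟨d, U, hU, hU0, g, hg, hg0⟩ := G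
  obtain rfl : d = 0 := by simpa using hlt
  obtain ⟨r, hr, hne⟩ := hP V hV h0 hVP
  exact hne (((hPG r hr).2.trans (congrArg g (Subsingleton.elim _ _))).trans hg0)

end Dimension

/-! ### Smooth factorizations of the square of the norm -/

section Analysis

/-- The derivative vanishes at the minimum, so it is `O(‖y‖)`; the mean value inequality on the ball
of radius `‖y‖` gains the second factor. -/
theorem isBigO_sq_of_isLocalMin {F : Type*} [NormedAddCommGroup F] [NormedSpace ℝ F] {g : F → ℝ}
    (hg : ContDiffAt ℝ 2 g 0) (hmin : IsLocalMin g 0) (h0 : g 0 = 0) :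
    g =O[𝓝 0] fun y => ‖y‖ ^ 2 := by
  have hd : fderiv ℝ g 0 = 0 := hmin.fderiv_eq_zero
  have hg' : (fun y => fderiv ℝ g y) =O[𝓝 0] fun y => y := by
    have := ((hg.fderiv_right (m := 1) (by norm_num)).differentiableAt (by simp)).isBigO_sub
    simpa [hd] using this
  obtain ⟨C, hCpos, hC⟩ := hg'.exists_pos
  have hdiff : ∀ᶠ y in 𝓝 (0 : F), DifferentiableAt ℝ g y :=
    (hg.eventually (by simp)).mono fun y hy => hy.differentiableAt (by simp)
  obtain ⟨ε, hε, hb⟩ := Metric.eventually_nhds_iff_ball.1 (hC.bound.and hdiff)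
  refine IsBigO.of_bound C (Metric.eventually_nhds_iff_ball.2 ⟨ε, hε, fun y hy => ?_⟩)
  have hsub : ∀ z ∈ Metric.closedBall (0 : F) ‖y‖, z ∈ Metric.ball (0 : F) ε := fun z hz => by
    rw [mem_ball_zero_iff] at hy ⊢
    exact (mem_closedBall_zero_iff.1 hz).trans_lt hy
  have hC1 : ∀ z ∈ Metric.closedBall (0 : F) ‖y‖, ‖fderiv ℝ g z‖ ≤ C * ‖y‖ := fun z hz =>
    (hb z (hsub z hz)).1.trans
      (mul_le_mul_of_nonneg_left (mem_closedBall_zero_iff.1 hz) hCpos.le)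
  have := (convex_closedBall (0 : F) ‖y‖).norm_image_sub_le_of_norm_fderiv_le
    (fun z hz => (hb z (hsub z hz)).2) hC1 (Metric.mem_closedBall_self (norm_nonneg y))
    (mem_closedBall_zero_iff.2 (le_refl ‖y‖))
  simpa [h0, pow_two, mul_assoc] using this

/-- The square of the norm of `ℝⁿ` does not factor smoothly through a nonnegative function of
fewer than `n` variables vanishing at the origin. -/
theorem le_of_norm_sq_eq_comp {n k : ℕ} {φ : E n → E k} (hφ : DifferentiableAt ℝ φ 0)
    (hφ0 : φ 0 = 0) {g : E k → ℝ} (hg : ContDiffAt ℝ 2 g 0) (hmin : IsLocalMin g 0) (h0 : g 0 = 0)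
    (h : ∀ᶠ r in 𝓝 0, ‖r‖ ^ 2 = g (φ r)) : n ≤ k := by
  have hinj : Function.Injective (fderiv ℝ φ 0) := by
    -- If the derivative kills `v`, then `φ (s • v) = o(s)`, so `g (φ (s • v)) = o(s²)`; but this is
    -- `s² ‖v‖²`, which forces `v = 0`.
    refine (injective_iff_map_eq_zero _).2 fun v hv => ?_
    have hline : HasDerivAt (fun s : ℝ => s • v) v 0 := by
      simpa using (hasDerivAt_id (0 : ℝ)).smul_const v
    have hφv : HasDerivAt (fun s : ℝ => φ (s • v)) 0 0 := by
      rw [← hv]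
      exact HasFDerivAt.comp_hasDerivAt (0 : ℝ) (by simpa using hφ.hasFDerivAt) hline
    have ho : (fun s : ℝ => φ (s • v)) =o[𝓝 0] fun s : ℝ => s := by
      simpa [hφ0] using hφv.isLittleO
    have hto : Tendsto (fun s : ℝ => φ (s • v)) (𝓝 0) (𝓝 0) := by
      simpa [hφ0] using hφv.continuousAt.tendsto
    have hO := ((isBigO_sq_of_isLocalMin hg hmin h0).comp_tendsto hto).trans_isLittleO
      (ho.norm_left.pow two_pos)
    have hlim : Tendsto (fun s : ℝ => s • v) (𝓝 0) (𝓝 0) := by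
      simpa using hline.continuousAt.tendsto
    have hfin : (fun s : ℝ => ‖v‖ ^ 2 * s ^ 2) =o[𝓝 0] fun s : ℝ => s ^ 2 := by
      refine hO.congr' ((hlim.eventually h).mono fun s hs => ?_) EventuallyEq.rfl
      rw [Function.comp_apply, ← hs, norm_smul, mul_pow, Real.norm_eq_abs, sq_abs, mul_comm]
    by_contra hv0
    have hself := (isLittleO_const_mul_left_iff (pow_ne_zero 2 (norm_ne_zero_iff.2 hv0))).1 hfin
    refine (isLittleO_irrefl ?_) (hself.mono (nhdsWithin_le_nhds (s := {0}ᶜ)))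
    have hne : ∀ᶠ s : ℝ in 𝓝[{0}ᶜ] 0, s ^ 2 ≠ 0 :=
      eventually_mem_nhdsWithin.mono fun s hs => pow_ne_zero 2 hs
    exact hne.frequently
  simpa using LinearMap.finrank_le_finrank_of_injective
    (f := (fderiv ℝ φ 0 : E n →ₗ[ℝ] E k)) hinj

end Analysis

/-! ### Dimension of spaces with a smooth coordinate -/

section Coordinate

variable {X : Type*} [DiffeologicalSpace X] {t : X → ℝ}

/-- Through any factor `G` of `p`, the function `t ∘ G` is smooth with minimum `0` at the origin, so
`le_of_norm_sq_eq_comp` applies. -/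
theorem le_dimAt_of_norm_sq (ht : DSmooth t) (hpos : ∀ y, 0 ≤ t y) {x : X} (hx : t x = 0) {n : ℕ}
    {p : E n → X} (hp : IsPlot p) (hp0 : p 0 = x) (hpt : ∀ r, t (p r) = ‖r‖ ^ 2) :
    (n : ℕ∞) ≤ dimAt x := by
  rcases Nat.eq_zero_or_pos n with rfl | hn
  · simp
  have : NeZero n := ⟨hn.ne'⟩
  refine le_dimAt_of_factor ⟨n, Set.univ, isOpen_univ, trivial, p, isPlotOn_univ.2 hp, hp0⟩ ?_ ?_
  · intro V hV h0 _
    obtain ⟨ε, hε, hεV⟩ := Metric.isOpen_iff.1 hV 0 h0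
    refine ⟨EuclideanSpace.single 0 (ε / 2), hεV ?_, fun hc => ?_⟩
    · simp [abs_of_pos hε, hε]
    · have := hpt (EuclideanSpace.single 0 (ε / 2))
      have hc' : p (EuclideanSpace.single 0 (ε / 2)) = x := hc
      rw [hc', hx] at this
      exact absurd this (ne_of_lt (pow_pos (by simpa using hε.ne') 2))
  · intro G V hV h0 _ φ hφ hφ0 hPG
    have hg : ContDiffAt ℝ ∞ (t ∘ G.toFun) 0 :=
      ((G.isPlotOn.dSmooth_comp ht).contDiffOn G.isOpen_dom).contDiffAt
        (G.isOpen_dom.mem_nhds G.zero_mem)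
    have hg0 : (t ∘ G.toFun) 0 = 0 := by rw [Function.comp_apply, G.map_zero, hx]
    refine le_of_norm_sq_eq_comp (g := t ∘ G.toFun)
      ((hφ.contDiffAt (hV.mem_nhds h0)).differentiableAt (by simp)) hφ0
      (hg.of_le (by norm_cast)) ?_ hg0 ?_
    · exact Eventually.of_forall fun y => hg0.trans_le (hpos _)
    · filter_upwards [hV.mem_nhds h0] with r hr
      rw [← hpt r]
      exact congrArg t (hPG r hr).2

/-- The section `σ`, translated so that `0` goes to `x`, is a plot `G` inverse to `t - t x`. Every
centered plot `P` factors near `0` as `G` after `t ∘ P - t x`. -/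
theorem dimAt_eq_one_of_section (ht : DSmooth t) (hinj : Function.Injective t) {σ : ℝ → X}
    (hσ : ∀ s, 0 < s → t (σ s) = s)
    (hplot : IsPlotOn (fun y : E 1 => σ (y 0)) {y | 0 < y 0}) {x : X} (hx : 0 < t x) :
    dimAt x = 1 := by
  have hshift : ContDiff ℝ ∞ fun y : E 1 => y + EuclideanSpace.single 0 (t x) :=
    contDiff_id.add contDiff_const
  let G : CenteredPlot x :=
    { dim := 1
      dom := {y | 0 < (y + EuclideanSpace.single 0 (t x) : E 1) 0}
      isOpen_dom := isOpen_lt continuous_const (by fun_prop)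
      zero_mem := by simpa using hx
      toFun := fun y => σ ((y + EuclideanSpace.single 0 (t x) : E 1) 0)
      isPlotOn := hplot.comp hshift.contDiffOn fun y hy => hy
      map_zero := hinj (by simpa using hσ _ hx) }
  refine le_antisymm ?_ (one_le_dimAt G ?_)
  · refine mod_cast dimAt_le_of_factor G fun P => ?_
    have hP := (P.isPlotOn.dSmooth_comp ht).contDiffOn P.isOpen_dom
    refine ⟨P.dom ∩ (t ∘ P.toFun) ⁻¹' Set.Ioi 0,
      hP.continuousOn.isOpen_inter_preimage P.isOpen_dom isOpen_Ioi,
      ⟨P.zero_mem, by simpa [P.map_zero] using hx⟩, Set.inter_subset_left,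
      fun r => (t (P.toFun r) - t x) • EuclideanSpace.single (0 : Fin 1) (1 : ℝ), ?_, ?_, ?_⟩
    · exact ((hP.mono Set.inter_subset_left).sub contDiffOn_const).smul contDiffOn_const
    · simp [P.map_zero]
    · rintro r ⟨-, hr⟩
      have hr' : 0 < t (P.toFun r) := hr
      exact ⟨by simpa [G] using hr', hinj (by simp [G, hσ _ hr'])⟩
  · intro V hV h0 hVG
    obtain ⟨ε, hε, hεV⟩ := Metric.isOpen_iff.1 hV 0 h0
    have hmem : (EuclideanSpace.single 0 (ε / 2) : E 1) ∈ V :=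
      hεV (by simp [abs_of_pos hε, hε])
    refine ⟨_, hmem, fun hc => ?_⟩
    have h1 : 0 < ε / 2 + t x := by positivity
    have := congrArg t hc
    simp [G, hσ _ h1, hε.ne'] at this

end Coordinate

/-! ### The half-lines `Δ_n` -/

section Delta

variable {n : ℕ}

@[simp]
theorem Delta.sq_mk (x : E n) : (Delta.sq (Delta.mk x) : ℝ) = ‖x‖ ^ 2 := rfl

/-- For equal norms, the reflection in the hyperplane orthogonal to `x - y` takes `x` to `y`. -/
theorem Delta.mk_eq_mk {x y : E n} : Delta.mk x = Delta.mk y ↔ ‖x‖ = ‖y‖ := by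
  refine ⟨fun h => ?_, fun h => Quotient.sound ⟨_, Submodule.reflection_sub h⟩⟩
  obtain ⟨g, rfl⟩ := Quotient.exact h
  exact (g.norm_map x).symm

theorem Delta.sq_injective : Function.Injective fun δ : Delta n => (Delta.sq δ : ℝ) := by
  intro a b h
  obtain ⟨x, rfl⟩ := Delta.mk_surjective a
  obtain ⟨y, rfl⟩ := Delta.mk_surjective b
  simp only [Delta.sq_mk] at h
  exact Delta.mk_eq_mk.2 ((sq_eq_sq₀ (norm_nonneg _) (norm_nonneg _)).1 h)

theorem Delta.dSmooth_sq : DSmooth fun δ : Delta n => (Delta.sq δ : ℝ) :=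
  dSmooth_quotientDiffeology_comp Delta.mk_surjective
    (contDiff_norm_sq ℝ (E := E n) (n := ∞)).dSmooth

theorem Delta.dSmooth_mk : DSmooth (Delta.mk (n := n)) :=
  fun _ p hp => (isPlot_quotientDiffeology_iff Delta.mk_surjective).2 fun _ =>
    ⟨Set.univ, isOpen_univ, trivial, p, isPlotOn_univ.2 hp, fun _ _ => rfl⟩

theorem QuotientHalfLine.dSmooth_sq [NeZero n] :
    DSmooth (Y := QuotientHalfLine n) (HalfLines.sq n) :=
  fun _ p hp => (isPlot_quotientDiffeology_iff (sq_surjective n)).2 fun _ =>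
    ⟨Set.univ, isOpen_univ, trivial, p, isPlotOn_univ.2 hp, fun _ _ => rfl⟩

/-- The coordinate `t`, as a bijection from `Δ_n` to the half-line. -/
def Delta.sqEquiv (n : ℕ) [NeZero n] : Delta n ≃ Set.Ici (0 : ℝ) :=
  Equiv.ofBijective Delta.sq ⟨fun _ _ h => Delta.sq_injective (congrArg Subtype.val h), fun s => by
    obtain ⟨x, rfl⟩ := sq_surjective n s
    exact ⟨Delta.mk x, rfl⟩⟩

/-- The coordinate `t`, as a diffeomorphism from `Δ_n` to the half-line with the quotient
diffeology. -/
def Delta.sqDiffeo (n : ℕ) [NeZero n] : Diffeo (Delta n) (QuotientHalfLine n) where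
  toEquiv := Delta.sqEquiv n
  smooth_toFun := dSmooth_quotientDiffeology_comp Delta.mk_surjective QuotientHalfLine.dSmooth_sq
  smooth_invFun := dSmooth_quotientDiffeology_comp (sq_surjective n) <| by
    convert! Delta.dSmooth_mk (n := n) using 1
    exact funext fun x => (Delta.sqEquiv n).symm_apply_apply (Delta.mk x)

theorem Delta.dimAt_le {δ : Delta n} (h : (Delta.sq δ : ℝ) = 0) : dimAt δ ≤ n := by
  have h0 : Delta.mk 0 = δ := Delta.sq_injective (by simp [h])
  refine dimAt_le_of_factor ⟨n, Set.univ, isOpen_univ, trivial, Delta.mk,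
    isPlotOn_univ.2 Delta.dSmooth_mk.isPlot, h0⟩ fun P => ?_
  obtain ⟨V, hV, h0V, hVP, q, hq, hpq⟩ :=
    exists_lift_of_isPlotOn_quotientDiffeology Delta.mk_surjective P.isPlotOn P.isOpen_dom P.zero_mem
  refine ⟨V, hV, h0V, hVP, q, hq.contDiffOn hV, ?_, fun r hr => ⟨trivial, hpq r hr⟩⟩
  -- The orbit of the origin is a single point, so any lift is automatically centered.
  have hq0 := Delta.mk_eq_mk.1 (h0.trans (P.map_zero.symm.trans (hpq 0 h0V)))
  exact norm_eq_zero.1 (hq0.symm.trans norm_zero)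

theorem Delta.dimAt_of_sq_eq_zero {δ : Delta n} (h : (Delta.sq δ : ℝ) = 0) : dimAt δ = n :=
  (Delta.dimAt_le h).antisymm <| le_dimAt_of_norm_sq Delta.dSmooth_sq (fun y => (Delta.sq y).2) h
    Delta.dSmooth_mk.isPlot (Delta.sq_injective (by simp [h])) fun _ => rfl

theorem Delta.dimAt_of_sq_pos {δ : Delta n} (h : 0 < (Delta.sq δ : ℝ)) : dimAt δ = 1 := by
  have : NeZero n := ⟨by
    rintro rfl
    obtain ⟨x, rfl⟩ := Delta.mk_surjective δ
    simp [Subsingleton.elim x 0] at h⟩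
  refine dimAt_eq_one_of_section Delta.dSmooth_sq Delta.sq_injective
    (σ := fun s => Delta.mk (Real.sqrt s • EuclideanSpace.single (0 : Fin n) (1 : ℝ))) ?_ ?_ h
  · intro s hs
    simp [norm_smul, Real.sq_sqrt hs.le]
  · refine isPlotOn_quotientDiffeology_of_lift Delta.mk_surjective
      (q := fun y : E 1 => Real.sqrt (y 0) • EuclideanSpace.single (0 : Fin n) (1 : ℝ))
      (isPlotOn_of_contDiffOn ?_) fun s _ => rfl
    refine ContDiffOn.smul (ContDiffOn.sqrt ?_ fun y hy => ne_of_gt hy) contDiffOn_const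
    exact ContDiff.contDiffOn (by fun_prop)

theorem Delta.not_diffeomorphic {m : ℕ} (hnm : n ≠ m) :
    ¬ Diffeomorphic (Delta n) (Delta m) := by
  -- The origin, of dimension `a`, goes to a point of dimension `b` or `1`. Used in both directions,
  -- this makes both indices `1`.
  have key : ∀ {a b : ℕ}, a ≠ b → Diffeo (Delta a) (Delta b) → a = 1 := by
    intro a b hab f
    have h0 : dimAt (Delta.mk (0 : E a)) = a := Delta.dimAt_of_sq_eq_zero (by simp)
    have hf := f.dimAt_eq (Delta.mk 0)
    rw [h0] at hf
    rcases (Set.mem_Ici.1 (Delta.sq (f.toFun (Delta.mk 0))).2).eq_or_lt with h | h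
    · rw [Delta.dimAt_of_sq_eq_zero h.symm] at hf
      exact absurd (by exact_mod_cast hf.symm) hab
    · rw [Delta.dimAt_of_sq_pos h] at hf
      exact_mod_cast hf.symm
  rintro ⟨f⟩
  exact hnm ((key hnm f).trans (key hnm.symm f.symm).symm)

end Delta

/-! ### The half-line `Δ_∞` -/

section DeltaInfty

theorem DeltaInfty.isPlot_iff {n : ℕ} {p : E n → DeltaInfty} :
    IsPlot p ↔ ContDiff ℝ ∞ fun r => (p r).val :=
  isPlot_iff_contDiff (X := ℝ)

theorem DeltaInfty.dSmooth_val : DSmooth DeltaInfty.val :=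
  fun _ _ hp => (DeltaInfty.isPlot_iff.1 hp).isPlot

theorem DeltaInfty.val_injective : Function.Injective DeltaInfty.val :=
  Subtype.val_injective

theorem DeltaInfty.dimAt_of_val_eq_zero {δ : DeltaInfty} (h : δ.val = 0) : dimAt δ = ⊤ := by
  refine ENat.eq_top_iff_forall_ge.2 fun n => ?_
  refine le_dimAt_of_norm_sq DeltaInfty.dSmooth_val (fun y => y.2) h (p := HalfLines.sq n)
    (DeltaInfty.isPlot_iff.2 (contDiff_norm_sq ℝ)) (DeltaInfty.val_injective ?_) fun _ => rfl
  rw [h]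
  simp [DeltaInfty.val, HalfLines.sq]

theorem DeltaInfty.dimAt_of_val_pos {δ : DeltaInfty} (h : 0 < δ.val) : dimAt δ = 1 := by
  refine dimAt_eq_one_of_section DeltaInfty.dSmooth_val DeltaInfty.val_injective
    -- The maximum only makes `σ` total; it is the identity for `s > 0`, where smoothness is needed.
    (σ := fun s => ⟨max s 0, le_max_right s 0⟩) (fun s hs => max_eq_left hs.le) ?_ h
  intro m f hf hpos
  refine DeltaInfty.isPlot_iff.2 ?_
  have hf' : ContDiff ℝ ∞ fun r => f r 0 := by fun_prop
  convert! hf' using 1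
  exact funext fun r => max_eq_left (hpos r).le

/-- Every point of `Δ_n` has finite dimension, whereas the origin of `Δ_∞` does not. -/
theorem Delta.not_diffeomorphic_deltaInfty (n : ℕ) : ¬ Diffeomorphic (Delta n) DeltaInfty := by
  rintro ⟨f⟩
  let o : DeltaInfty := ⟨0, Set.mem_Ici.2 le_rfl⟩
  have hf := f.symm.dimAt_eq o
  rw [DeltaInfty.dimAt_of_val_eq_zero rfl] at hf
  set δ := f.symm.toFun o
  rcases (Set.mem_Ici.1 (Delta.sq δ).2).eq_or_lt with h | h
  · exact ENat.natCast_ne_top n ((Delta.dimAt_of_sq_eq_zero h.symm).symm.trans hf)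
  · exact ENat.one_ne_top ((Delta.dimAt_of_sq_pos h).symm.trans hf)

end DeltaInfty

end HalfLines

end

theorem mainTheorem4 :
    -- for `n ≥ 1`, `sq` identifies `Δ_n` with `[0, ∞[` with the quotient diffeology of `sq`
    (∀ (n : ℕ) [NeZero n], ∃ f : HalfLines.Diffeo (HalfLines.Delta n) (HalfLines.QuotientHalfLine n),
      ∀ δ : HalfLines.Delta n, (f.toFun δ).val = (HalfLines.Delta.sq δ : ℝ)) ∧
    -- the half-lines are pairwise not diffeomorphic
    (∀ n m : ℕ, n ≠ m →
      ¬ HalfLines.Diffeomorphic (HalfLines.Delta n) (HalfLines.Delta m)) ∧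
    (∀ n : ℕ, ¬ HalfLines.Diffeomorphic (HalfLines.Delta n) HalfLines.DeltaInfty) ∧
    -- the dimension map is a diffeological invariant
    (∀ (X : Type*) (Y : Type*) [DiffeologicalSpace X] [DiffeologicalSpace Y]
      (f : HalfLines.Diffeo X Y) (x : X), HalfLines.dimAt (f.toFun x) = HalfLines.dimAt x) ∧
    -- the dimension map of the half-lines
    (∀ (n : ℕ) (δ : HalfLines.Delta n),
      ((HalfLines.Delta.sq δ : ℝ) = 0 → HalfLines.dimAt δ = (n : ℕ∞)) ∧
      (0 < (HalfLines.Delta.sq δ : ℝ) → HalfLines.dimAt δ = 1)) ∧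
    (∀ δ : HalfLines.DeltaInfty,
      (δ.val = 0 → HalfLines.dimAt δ = ⊤) ∧
      (0 < δ.val → HalfLines.dimAt δ = 1)) :=
  ⟨fun n _ => ⟨HalfLines.Delta.sqDiffeo n, fun _ => rfl⟩,
    fun _ _ => HalfLines.Delta.not_diffeomorphic,
    HalfLines.Delta.not_diffeomorphic_deltaInfty,
    fun _ _ _ _ f x => f.dimAt_eq x,
    fun _ _ => ⟨HalfLines.Delta.dimAt_of_sq_eq_zero, HalfLines.Delta.dimAt_of_sq_pos⟩,
    fun _ => ⟨HalfLines.DeltaInfty.dimAt_of_val_eq_zero, HalfLines.DeltaInfty.dimAt_of_val_pos⟩⟩
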